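/- Let $q$ be a prime power, let $\ell',t>1$ be integers and let $n=\ell' t$. Let $\mu\in\mathbb F_{q^n}^*$ with $\mathbb F_q(\mu)=\mathbb F_{q^t}$, let $\overline S$ be an $\mathbb F_{q^t}$-subspace of $\mathbb F_{q^n}$ of $\mathbb F_{q^t}$-dimension $\ell$ with $1\le \ell<\ell'$, and let $b\in\mathbb F_{q^n}^*$ be such that $\overline S\cap b\,\mathbb F_{q^t}=\{0\}$. Let $m\ge 1$ and $j\ge 2$ be integers with $m+j\le t+1$ and suppose that $n=\ell t+m+j$. Let $\lambda\in\mathbb F_{q^n}\setminus\mathbb F_q$ with $\mathbb F_q(\lambda)=\mathbb F_{q^s}$ and $\ell t+m+j\le s+1$, and put $k=\ell t+m$. Consider the $\mathbb F_q$-subspaces of $\mathbb F_{q^n}^2$ $$U_1=\bigl(\overline S\oplus b\langle 1,\mu,\ldots,\mu^{m-1}\rangle_{\mathbb F_q}\bigr)\times\langle 1,\mu,\ldots,\mu^{j-1}\rangle_{\mathbb F_q},\qquad U_2=\langle 1,\lambda,\ldots,\lambda^{k-1}\rangle_{\mathbb F_q}\times\langle 1,\lambda,\ldots,\lambda^{j-1}\rangle_{\mathbb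 F_q}.$$ Then $U_1$ and $U_2$ are $\Gamma\mathrm L(2,q^n)$-inequivalent: no invertible map of $\mathbb F_{q^n}^2$ that is semilinear with respect to some automorphism of the field $\mathbb F_{q^n}$ maps $U_1$ onto $U_2$. No assumption is made on the weight distributions of the associated linear sets, so this holds in particular whenever these distributions coincide. -/

import Mathlib

open scoped IntermediateField

/-- The `F`-subspace `⟨1, x, …, x ^ (d - 1)⟩` of `L` spanned by the first `d` powers of `x`. -/
def powerSpan (F : Type*) {L : Type*} [Field F] [Field L] [Algebra F L] (x : L) (d : ℕ) :
    Submodule F L :=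
  Submodule.span F (Set.range fun i : Fin d => x ^ (i : ℕ))

/-- The `F`-subspace `S + b⟨1, μ, …, μ ^ (m - 1)⟩` of `L`, where `S` is a subspace over the
field `F(μ)`. The sum is direct whenever `S ∩ b F(μ) = 0` and `m ≤ [F(μ) : F]`. -/
def extendedSubspace {F L : Type*} [Field F] [Field L] [Algebra F L] (μ : L)
    (S : Submodule F⟮μ⟯ L) (b : L) (m : ℕ) : Submodule F L :=
  S.restrictScalars F ⊔ (powerSpan F μ m).map (LinearMap.mulLeft F b)

/-- Two `F`-subspaces `U` and `W` of `L²` are `ΓL(2, L)`-equivalent: some invertible semilinear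
map of `L²`, with respect to an arbitrary field automorphism `ρ` of `L`, maps `U` onto `W`. -/
def GammaLEquivalent {F L : Type*} [Field F] [Field L] [Algebra F L]
    (U W : Submodule F (L × L)) : Prop :=
  ∃ (ρ : L ≃+* L) (φ : (L × L) ≃+ (L × L)),
    (∀ (c : L) (v : L × L), φ (c • v) = ρ c • φ v) ∧
      φ '' (U : Set (L × L)) = (W : Set (L × L))

section PowerSpan

variable {F L : Type*} [Field F] [Field L] [Algebra F L]

/-! The numerical hypotheses force `l' = l + 1`, so `S` is an `F(μ)`-hyperplane of `L`, and force
`lam` to generate `L`. A semilinear equivalence sends `S × 0` into the second subspace; the second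
factor is too small to receive a copy of `S`, so `ρ(S)a ⊆ ⟨1, …, lam^(k-1)⟩` with `a ≠ 0`.
Multiplying by `lam` enlarges the power span by at most one dimension, still short of `L`. Hence `S
+ ρ⁻¹(lam)S` is proper and equals the hyperplane `S`, which is then stable under a generator of `L`:
impossible (`not_image_subset_powerSpan_of_hyperplane`). -/

lemma finrank_powerSpan_le (x : L) (d : ℕ) : Module.finrank F (powerSpan F x d) ≤ d :=
  (finrank_range_le_card (R := F) fun i : Fin d => x ^ (i : ℕ)).trans_eq (Fintype.card_fin d)

lemma natCard_powerSpan_le [Finite F] [FiniteDimensional F L] (x : L) (d : ℕ) :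
    Nat.card (powerSpan F x d) ≤ Nat.card F ^ d := by
  rw [Module.natCard_eq_pow_finrank (K := F)]
  exact Nat.pow_le_pow_right Nat.card_pos (finrank_powerSpan_le x d)

lemma powerSpan_mono (x : L) {d e : ℕ} (h : d ≤ e) : powerSpan F x d ≤ powerSpan F x e := by
  refine Submodule.span_mono ?_
  rintro _ ⟨i, rfl⟩
  exact ⟨⟨i, i.2.trans_le h⟩, rfl⟩

lemma mul_mem_powerSpan_succ (x : L) {d : ℕ} {y : L} (hy : y ∈ powerSpan F x d) :
    x * y ∈ powerSpan F x (d + 1) := by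
  have h : powerSpan F x d ≤ (powerSpan F x (d + 1)).comap (LinearMap.mulLeft F x) := by
    refine Submodule.span_le.2 ?_
    rintro _ ⟨i, rfl⟩
    refine Submodule.subset_span ⟨⟨i + 1, by omega⟩, ?_⟩
    simp [pow_succ']
  exact h hy

end PowerSpan

section FiniteField

variable {F L : Type*} [Field F] [Finite F] [Field L] [Algebra F L]

/-- An automorphism of an extension of a finite field maps that field into itself. -/
lemma RingEquiv.map_algebraMap_mem_range_of_finite (σ : L ≃+* L) (c : F) :
    σ (algebraMap F L c) ∈ Set.range (algebraMap F L) := by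
  classical
  have := Fintype.ofFinite F
  have hq : 1 < Fintype.card F := Fintype.one_lt_card
  have hsub : (Finset.univ.image (algebraMap F L)) ⊆
      (Polynomial.X ^ Fintype.card F - Polynomial.X : Polynomial L).roots.toFinset := by
    intro y hy
    obtain ⟨a, -, rfl⟩ := Finset.mem_image.1 hy
    rw [Multiset.mem_toFinset, Polynomial.mem_roots (FiniteField.X_pow_card_sub_X_ne_zero L hq)]
    simp [Polynomial.IsRoot, ← map_pow, FiniteField.pow_card]
  -- `X^q - X` has at most `q` roots, so the copy of `F` is its full root set, which `σ` preserves.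
  have heq := Finset.eq_of_subset_of_card_le hsub <| by
    rw [Finset.card_image_of_injective _ (algebraMap F L).injective, Finset.card_univ]
    refine (Multiset.toFinset_card_le _).trans ((Polynomial.card_roots' _).trans ?_)
    rw [FiniteField.X_pow_card_sub_X_natDegree_eq L hq]
  have hmem : σ (algebraMap F L c) ∈ Finset.univ.image (algebraMap F L) := by
    rw [heq, Multiset.mem_toFinset,
      Polynomial.mem_roots (FiniteField.X_pow_card_sub_X_ne_zero L hq)]
    simp [Polynomial.IsRoot, ← map_pow, FiniteField.pow_card]
  simpa using hmem

end FiniteField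

section Stable

variable {F L : Type*} [Field F] [Finite F] [Field L] [Algebra F L]

/-- A nonzero subspace over `F(μ)` that is stable under multiplication by a conjugate of a
generator of `L` over `F` is the whole of `L`. -/
lemma Submodule.eq_top_of_mul_mem_of_adjoin_eq_top {μ : L} (S : Submodule F⟮μ⟯ L) (hS : S ≠ ⊥)
    (σ : L ≃+* L) {x : L} (hx : Algebra.adjoin F {x} = ⊤)
    (hstable : ∀ y ∈ S, σ x * y ∈ S) : S = ⊤ := by
  -- The `z` for which `σ z` stabilises `S` form an `F`-subalgebra, since `σ` preserves `F`.
  have hall : ∀ z : L, ∀ y ∈ S, σ z * y ∈ S := by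
    intro z
    have hz : z ∈ Algebra.adjoin F {x} := hx ▸ Algebra.mem_top
    induction hz using Algebra.adjoin_induction with
    | mem z hz =>
      rw [Set.mem_singleton_iff.1 hz]
      exact hstable
    | algebraMap c =>
      intro y hy
      obtain ⟨a, ha⟩ := σ.map_algebraMap_mem_range_of_finite c
      rw [← ha]
      exact S.smul_mem (algebraMap F F⟮μ⟯ a) hy
    | add u v _ _ hu hv =>
      intro y hy
      rw [map_add, add_mul]
      exact S.add_mem (hu y hy) (hv y hy)
    | mul u v _ _ hu hv =>
      intro y hy
      rw [map_mul, mul_assoc]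
      exact hu _ (hv y hy)
  obtain ⟨y, hy, hy0⟩ := S.exists_mem_ne_zero_of_ne_bot hS
  refine eq_top_iff.2 fun z _ => ?_
  simpa [hy0] using hall (σ.symm (z * y⁻¹)) y hy

end Stable

section Main

variable {F L : Type*} [Field F] [Field L] [Algebra F L] [FiniteDimensional F L]

lemma natCard_submodule_adjoin {μ : L} (S : Submodule F⟮μ⟯ L) :
    Nat.card S = Nat.card F ^ (Module.finrank F⟮μ⟯ S * Module.finrank F F⟮μ⟯) := by
  rw [Module.natCard_eq_pow_finrank (K := F⟮μ⟯) (V := S),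
    Module.natCard_eq_pow_finrank (K := F) (V := F⟮μ⟯), ← pow_mul, mul_comm]

variable [Finite F]

/-- A semilinear image of a subspace `S` over `F(μ)` inside `⟨1, x, …, x ^ (d - 1)⟩` bounds the
dimension of `S`. -/
lemma finrank_mul_le_of_image_subset_powerSpan {μ : L} (S : Submodule F⟮μ⟯ L) (ρ : L ≃+* L)
    {a x : L} (ha : a ≠ 0) {d : ℕ} (h : ∀ y ∈ S, ρ y * a ∈ powerSpan F x d) :
    Module.finrank F⟮μ⟯ S * Module.finrank F F⟮μ⟯ ≤ d := by
  have : Finite L := Module.finite_of_finite F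
  have hcard : Nat.card S ≤ Nat.card (powerSpan F x d) := by
    refine Nat.card_le_card_of_injective (fun y : S => (⟨ρ y * a, h y y.2⟩ : powerSpan F x d)) ?_
    intro y z hyz
    exact Subtype.ext (ρ.injective (mul_right_cancel₀ ha (Subtype.ext_iff.1 hyz)))
  rw [natCard_submodule_adjoin] at hcard
  exact (Nat.pow_le_pow_iff_right Finite.one_lt_card).1
    (hcard.trans (natCard_powerSpan_le x d))

/-- No semilinear image of a nonzero `F(μ)`-hyperplane of `L` lies in
`⟨1, x, …, x ^ (d - 1)⟩` when `x` generates `L` and `d + 1 < [L : F]`. -/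
lemma not_image_subset_powerSpan_of_hyperplane {μ : L} (S : Submodule F⟮μ⟯ L) (hS : S ≠ ⊥)
    (hfin : Module.finrank F⟮μ⟯ L = Module.finrank F⟮μ⟯ S + 1) (ρ : L ≃+* L)
    {a x : L} (ha : a ≠ 0) (hx : Algebra.adjoin F {x} = ⊤) {d : ℕ}
    (hd : d + 1 < Module.finrank F L) :
    ¬ ∀ y ∈ S, ρ y * a ∈ powerSpan F x d := by
  intro h
  set T : Submodule F⟮μ⟯ L := S ⊔ S.map (LinearMap.mulLeft F⟮μ⟯ (ρ.symm x)) with hT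
  have hTimage : ∀ y ∈ T, ρ y * a ∈ powerSpan F x (d + 1) := by
    intro y hy
    obtain ⟨u, hu, _, ⟨v, hv, rfl⟩, rfl⟩ := Submodule.mem_sup.1 hy
    have hv' := mul_mem_powerSpan_succ x (h v hv)
    simpa [add_mul, mul_assoc] using
      add_mem (powerSpan_mono x d.le_succ (h u hu)) hv'
  have hTle := finrank_mul_le_of_image_subset_powerSpan T ρ ha hTimage
  -- `T = L` would give `[L : F] ≤ d + 1`.
  have hTlt : Module.finrank F⟮μ⟯ T < Module.finrank F⟮μ⟯ L := by
    by_contra! hge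
    have hmul := Nat.mul_le_mul_right (Module.finrank F F⟮μ⟯) hge
    rw [mul_comm, Module.finrank_mul_finrank] at hmul
    omega
  have hST : S = T := Submodule.eq_of_le_of_finrank_le le_sup_left (by omega)
  have htop : S = ⊤ := S.eq_top_of_mul_mem_of_adjoin_eq_top hS ρ.symm hx fun y hy => by
    rw [hST]
    exact Submodule.mem_sup_right ⟨y, hy, rfl⟩
  rw [htop, finrank_top] at hfin
  omega

end Main

theorem mainTheorem5 {F L : Type*} [Field F] [Finite F] [Field L] [Algebra F L]
    [FiniteDimensional F L]
    (n t l l' m j s k : ℕ)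
    (hn : Module.finrank F L = n)
    (hl' : 1 < l') (ht : 1 < t) (hnt : n = l' * t)
    (μ : L) (hμ : μ ≠ 0) (hμt : Module.finrank F F⟮μ⟯ = t)
    (S : Submodule F⟮μ⟯ L) (hS : Module.finrank F⟮μ⟯ S = l) (hl : 1 ≤ l) (hll' : l < l')
    (b : L) (hb : b ≠ 0) (hSb : S ⊓ Submodule.span F⟮μ⟯ {b} = ⊥)
    (hm : 0 < m) (hj : 2 ≤ j) (hmj : m + j ≤ t + 1)
    (hrank : n = l * t + m + j)
    (lam : L) (hlam : lam ∉ Set.range (algebraMap F L))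
    (hlams : Module.finrank F F⟮lam⟯ = s) (hs : l * t + m + j ≤ s + 1)
    (hk : k = l * t + m) :
    ¬ GammaLEquivalent
        ((extendedSubspace μ S b m).prod (powerSpan F μ j))
        ((powerSpan F lam k).prod (powerSpan F lam j)) := by
  rintro ⟨ρ, φ, hφ, himage⟩
  -- Otherwise `m + j ≥ 2t > t + 1`.
  have hl1 : l' = l + 1 := by
    by_contra hne
    have : (l + 2) * t ≤ l' * t := Nat.mul_le_mul_right t (by omega)
    rw [← hnt, hrank, add_mul] at this
    omega
  have hmjt : m + j = t := by
    have : n = l * t + t := by rw [hnt, hl1, add_mul, one_mul]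
    omega
  have hlt : t ≤ l * t := Nat.le_mul_of_pos_left t hl
  have hsn : s = n := by
    have hdvd : s ∣ n := by
      rw [← hlams, ← hn]
      exact ⟨_, (Module.finrank_mul_finrank F F⟮lam⟯ L).symm⟩
    have hsle : s ≤ n := Nat.le_of_dvd (by omega) hdvd
    by_contra hne
    -- The only other case, `s = n - 1`, would force `n = 2`, whereas `n ≥ 2t ≥ 4`.
    have hone : s ∣ 1 := by
      have hn1 : n = s + 1 := by omega
      rw [hn1] at hdvd
      exact (Nat.dvd_add_right dvd_rfl).1 hdvd
    have := Nat.le_of_dvd one_pos hone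
    omega
  have hadj : Algebra.adjoin F {lam} = ⊤ := by
    have htop : F⟮lam⟯ = ⊤ := by
      apply IntermediateField.eq_of_le_of_finrank_le le_top
      rw [IntermediateField.finrank_top', hn, hlams, hsn]
    rw [← IntermediateField.adjoin_simple_toSubalgebra_of_isAlgebraic
      (Algebra.IsAlgebraic.isAlgebraic lam), htop, IntermediateField.top_toSubalgebra]
  have himg : ∀ y ∈ S, ρ y * (φ (1, 0)).1 ∈ powerSpan F lam k ∧
      ρ y * (φ (1, 0)).2 ∈ powerSpan F lam j := by
    intro y hy
    have hmem : φ (y, 0) ∈ ((powerSpan F lam k).prod (powerSpan F lam j) : Set (L × L)) := by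
      rw [← himage]
      exact ⟨_, ⟨Submodule.mem_sup_left ((S.restrictScalars_mem F y).2 hy), zero_mem _⟩, rfl⟩
    have hy1 : φ (y, 0) = ρ y • φ (1, 0) := by rw [← hφ]; simp
    rw [hy1] at hmem
    exact hmem
  -- Otherwise `lt ≤ j`, but `j < t` because `m > 0`.
  have hd : (φ (1, 0)).2 = 0 := by
    by_contra hd
    have := finrank_mul_le_of_image_subset_powerSpan S ρ hd fun y hy => (himg y hy).2
    rw [hS, hμt] at this
    omega
  have ha : (φ (1, 0)).1 ≠ 0 := by
    intro ha
    have hzero : φ (1, 0) = φ 0 := by rw [map_zero]; exact Prod.ext ha hd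
    simpa using φ.injective hzero
  have hfin : Module.finrank F⟮μ⟯ L = Module.finrank F⟮μ⟯ S + 1 := by
    have hmul := Module.finrank_mul_finrank F F⟮μ⟯ L
    rw [hμt, hn, hnt, mul_comm] at hmul
    rw [Nat.eq_of_mul_eq_mul_right (by omega) hmul, hS, hl1]
  have hSbot : S ≠ ⊥ := by
    rintro rfl
    rw [finrank_bot] at hS
    omega
  -- Here `k + 1 = n - j + 1 < n` is exactly where `j ≥ 2` enters.
  exact not_image_subset_powerSpan_of_hyperplane S hSbot hfin ρ ha hadj
    (by rw [hn]; omega) fun y hy => (himg y hy).1
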